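/- For a positive integer $n$, let $\|n\|$ (the complexity of $n$) be the least number of $1$'s needed to write $n$ using $1$, addition and multiplication (with any bracketing), and let $\delta(n)=\|n\|-3\log_3 n$ (the defect of $n$). Call $n$ stable if $\|3^k n\|=3k+\|n\|$ for all $k\ge 1$. Let $\mathscr{D}=\{\delta(n): n\ge 1\}$, let $\mathscr{D}_{st}=\{\delta(n): n\ge 1,\ n\text{ stable}\}$, and for a congruence class $a$ modulo $3$ let $\mathscr{D}^a=\{\delta(n): n>1,\ \|n\|\equiv a \pmod 3\}$ and $\mathscr{D}^a_{st}=\mathscr{D}^a\cap\mathscr{D}_{st}$. All these are sets of real numbers with the usual order, bars denote closures in $\mathbb{R}$, and elements of well-ordered sets are counted from $0$ (so an element of a well-ordered set is its $\alpha$-th element if the elements below it have order type $\alpha$). Below $k$ denotes a nonnegative integer. Then: 1. $\mathscr{D}$ and $\mathscr{D}_{st}$ are well-ordered, both with order type $\omega^\omega$. Furthermore, $\mathscr{D}_{st}\cap[0,k]$ has order type $\omega^k$ for every $k\ge 0$, and, for $k\ne 1$, so does $\mathscr{D}\cap[0,k]$. 2. $\overline{\mathscr{D}_{st}}$ and $\overline{\mathscr{D}}$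 are well-ordered, both with order type $\omega^\omega$. Furthermore, for $k\ge 1$, the sets $\overline{\mathscr{D}_{st}}\cap[0,k]$ and $\overline{\mathscr{D}}\cap[0,k]$ have order type $\omega^k+1$, and $k$ belongs to both $\overline{\mathscr{D}_{st}}$ and $\overline{\mathscr{D}}$ and is the $\omega^k$-th element of each. 3. For each $a$ modulo $3$, $\mathscr{D}^a$ and $\mathscr{D}^a_{st}$ are well-ordered, each with order type $\omega^\omega$. Furthermore, if $k\ge 0$ and $k\equiv a\pmod 3$, then $\mathscr{D}^a\cap[0,k]$ and $\mathscr{D}^a_{st}\cap[0,k]$ have order type $\omega^k$. 4. For each $a$ modulo $3$, $\overline{\mathscr{D}^a}$ and $\overline{\mathscr{D}^a_{st}}$ are well-ordered, each with order type $\omega^\omega$. Furthermore, if $k\ge 1$ and $k\equiv a\pmod 3$, then $\overline{\mathscr{D}^a}\cap[0,k]$ and $\overline{\mathscr{D}^a_{st}}\cap[0,k]$ have order type $\omega^k+1$, and $k$ belongs to both $\overline{\mathscr{D}^a}$ and $\overline{\mathscr{D}^a_{st}}$ and is the $\omega^k$-th element of each. -/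

import Mathlib

open scoped Ordinal

namespace IntegerComplexity

/-- Formal expressions built from the constant `1` with addition and multiplication. -/
inductive Expr : Type
  | one : Expr
  | add : Expr → Expr → Expr
  | mul : Expr → Expr → Expr

/-- The natural number denoted by an expression. -/
def Expr.value : Expr → ℕ
  | .one => 1
  | .add e f => e.value + f.value
  | .mul e f => e.value * f.value

/-- The number of ones written in an expression. -/
def Expr.ones : Expr → ℕ
  | .one => 1
  | .add e f => e.ones + f.ones
  | .mul e f => e.ones + f.ones

/-- The complexity `‖n‖` of a positive integer `n`: the least number of ones in an expression
for `n`. (It is only used for `n ≥ 1`; the value at `0` is the junk value `sInf ∅ = 0`.) -/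
noncomputable def complexity (n : ℕ) : ℕ :=
  sInf {m : ℕ | ∃ e : Expr, e.value = n ∧ e.ones = m}

/-- Every positive integer is denoted by some expression, so that for `n ≥ 1` the infimum in
`complexity n` is attained. -/
theorem exists_expr {n : ℕ} (hn : 1 ≤ n) : ∃ e : Expr, e.value = n ∧ e.ones = complexity n := by
  have h : ∃ e : Expr, e.value = n := by
    induction n, hn using Nat.le_induction with
    | base => exact ⟨.one, rfl⟩
    | succ k _ ih =>
      obtain ⟨e, he⟩ := ih
      exact ⟨.add e .one, by simp [Expr.value, he]⟩
  obtain ⟨e, he⟩ := h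
  have hne : {m : ℕ | ∃ e : Expr, e.value = n ∧ e.ones = m}.Nonempty := ⟨e.ones, e, he, rfl⟩
  exact Nat.sInf_mem hne

/-- The defect `δ(n) = ‖n‖ - 3 log₃ n`. -/
noncomputable def defect (n : ℕ) : ℝ :=
  (complexity n : ℝ) - 3 * Real.logb 3 (n : ℝ)

/-- `n` is stable if `‖3 ^ k n‖ = 3 k + ‖n‖` for every `k ≥ 1`. -/
def IsStable (n : ℕ) : Prop :=
  ∀ k : ℕ, 1 ≤ k → complexity (3 ^ k * n) = 3 * k + complexity n

/-- The set `𝒟` of all defects of positive integers. -/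
def defectSet : Set ℝ :=
  {x | ∃ n : ℕ, 1 ≤ n ∧ defect n = x}

/-- The set `𝒟_st` of all defects of stable positive integers. -/
def stableDefectSet : Set ℝ :=
  {x | ∃ n : ℕ, 1 ≤ n ∧ IsStable n ∧ defect n = x}

/-- The set `𝒟^a` of all defects of integers `n > 1` with `‖n‖ ≡ a (mod 3)`. -/
def defectSetMod (a : ZMod 3) : Set ℝ :=
  {x | ∃ n : ℕ, 1 ≤ n ∧ n ≠ 1 ∧ (complexity n : ZMod 3) = a ∧ defect n = x}

/-- The set `𝒟^a_st = 𝒟^a ∩ 𝒟_st`. -/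
def stableDefectSetMod (a : ZMod 3) : Set ℝ :=
  defectSetMod a ∩ stableDefectSet

/-- The set `S` of real numbers is well-ordered (by the usual `<`), with order type `o`. -/
def HasOrderType (S : Set ℝ) (o : Ordinal.{0}) : Prop :=
  ∃ _ : IsWellOrder S (fun x y => x < y), Ordinal.type (fun x y : S => x < y) = o

/-- `x` is the `o`-th element of the well-ordered set `S` of real numbers, counting from zero:
`x` belongs to `S`, and the elements of `S` below `x` have order type `o`. -/
def IsNthElement (S : Set ℝ) (o : Ordinal.{0}) (x : ℝ) : Prop :=
  S.IsWF ∧ x ∈ S ∧ HasOrderType (S ∩ Set.Iio x) o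

end IntegerComplexity

open IntegerComplexity

/-!
The proof compares every set in the theorem with two explicit ones. Write `𝒟^a_st` for the stable
defects in the class `a` modulo `3`, and `Z` (`shiftedDefectSet`) for the set of all `δ(m) + r` with
`m ≥ 1` and `r ∈ ℕ`. The defect sets and their closures all contain some `𝒟^a_st` (those without a
residue class contain all three) and are contained in `Z`. So it suffices to bound the order
types of the initial segments of `Z` from above and those of `𝒟^a_st` from below.

Everything about `Z` comes from a compactness statement (`hasDefectLimit_of_eventually_le`): along
an ultrafilter, a bounded function with values in `Z` is either eventually constant, or converges,
strictly from below, to a point of `Z + 1`. For defects of integers `n` this is proved by induction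
on the bound, in small steps. Take `n` least with its defect and look at the last operation of a
shortest expression of `n`. For a product, `δ(uv) = δ(u) + δ(v)`, where both summands are at least
`1 / 10`, so the induction hypothesis applies to both; sums of elements of `Z` are in `Z`. For
a sum `n = a + b` with `b ≤ a`, one has `δ(n) = δ(a) + ‖b‖ - 3 log₃ (1 + b / a)`; here `b` is bounded,
hence constant along the ultrafilter, and either `a` is constant too, or `a` tends to infinity, and
then `δ(n)` tends from below to the limit of `δ(a)` plus `‖b‖ ≥ 1`.

It follows that `Z` is closed and well-ordered and that its accumulation points lie in `Z + 1`.
Hence the order type of `Z` below `x` is less than `ω * (α + 1)`, where `α` is the order type of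
`Z` up to `x - 1` (`otype_shiftedDefectSet_inter_Iio_lt`), and below any `x < k` it is less than
`ω ^ k`.

Conversely, let `m` be stable. The numbers `3 ^ j * m + 1`, made stable by multiplying with powers of
`3`, have defects `δ(m) + e - ε` with an integer `e ≤ 1` and small `ε > 0`. If `e ≤ 0` for arbitrarily
large `j`, the compactness statement would give `δ(m) + e = δ(m') + r` with `r ≥ 1`; but defects that
differ by an integer belong to numbers whose quotient is a power of `3`, and this contradicts the
stability of `m`. So `δ(m) + 1` is a limit from below of `𝒟^(a+1)_st` for every `δ(m)` in `𝒟^a_st`,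
which gives at least the order type `ω ^ k` for the elements of `𝒟^k_st` below `k`
(`opow_le_otype_stableDefectSetMod`). Since the part of `Z` below any `x < k` is shorter than that,
`k` is in the closure (`natCast_mem_closure`).
-/

namespace IntegerComplexity

open Filter Topology

/-! ### Elementary properties of the complexity and the defect -/

theorem Expr.one_le_value (e : Expr) : 1 ≤ e.value := by
  induction e with
  | one => exact le_rfl
  | add e f he hf => simp only [Expr.value]; omega
  | mul e f he hf => exact Nat.mul_pos he hf

theorem Expr.one_le_ones (e : Expr) : 1 ≤ e.ones := by
  induction e with
  | one => exact le_rfl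
  | add e f he hf => simp only [Expr.ones]; omega
  | mul e f he hf => simp only [Expr.ones]; omega

theorem complexity_value_le (e : Expr) : complexity e.value ≤ e.ones :=
  Nat.sInf_le ⟨e, rfl, rfl⟩

theorem succ_cube_le {x m k : ℕ} (hx : x ^ 3 ≤ 3 ^ m) (hm : 1 ≤ m) (hk : 1 ≤ k) :
    (x + 1) ^ 3 ≤ 3 ^ (m + k) := by
  have h1 : 3 ^ (m + 1) ≤ 3 ^ (m + k) := Nat.pow_le_pow_right (by norm_num) (by omega)
  refine le_trans ?_ h1
  rcases Nat.lt_or_ge x 3 with h | h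
  · have hx2 : x = 2 → 2 ≤ m := by
      rintro rfl
      by_contra hlt
      obtain rfl : m = 1 := by omega
      norm_num at hx
    have h3 : 3 ^ 2 ≤ 3 ^ (m + 1) := Nat.pow_le_pow_right (by norm_num) (by omega)
    interval_cases x
    · omega
    · omega
    · exact Nat.pow_le_pow_right (n := 3) (by norm_num) (by have := hx2 rfl; omega)
  · obtain ⟨y, rfl⟩ := Nat.exists_eq_add_of_le h
    calc (3 + y + 1) ^ 3 ≤ (3 + y) ^ 3 * 3 := by ring_nf; nlinarith [Nat.zero_le (y ^ 3)]
      _ ≤ 3 ^ (m + 1) := by rw [pow_succ 3 m]; exact Nat.mul_le_mul_right _ hx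

/-- The classical lower bound `‖n‖ ≥ 3 log₃ n`, in multiplicative form and for expressions. -/
theorem Expr.value_cube_le (e : Expr) : e.value ^ 3 ≤ 3 ^ e.ones := by
  induction e with
  | one => norm_num [Expr.value, Expr.ones]
  | mul e f he hf =>
    simp only [Expr.value, Expr.ones, mul_pow, pow_add]
    exact Nat.mul_le_mul he hf
  | add e f he hf =>
    simp only [Expr.value, Expr.ones]
    have := e.one_le_value
    have := f.one_le_value
    rcases Nat.lt_or_ge f.value 2 with h | h
    · rw [show f.value = 1 by omega]
      exact succ_cube_le he e.one_le_ones f.one_le_ones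
    rcases Nat.lt_or_ge e.value 2 with h' | h'
    · rw [show e.value = 1 by omega, add_comm, add_comm e.ones]
      exact succ_cube_le hf f.one_le_ones e.one_le_ones
    · calc (e.value + f.value) ^ 3 ≤ (e.value * f.value) ^ 3 :=
            Nat.pow_le_pow_left (by nlinarith) 3
        _ ≤ _ := by rw [mul_pow, pow_add]; exact Nat.mul_le_mul he hf

theorem cube_le_pow_complexity {n : ℕ} (hn : 1 ≤ n) : n ^ 3 ≤ 3 ^ complexity n := by
  obtain ⟨e, rfl, he⟩ := exists_expr hn
  rw [← he]
  exact e.value_cube_le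

theorem one_le_complexity {n : ℕ} (hn : 1 ≤ n) : 1 ≤ complexity n := by
  obtain ⟨e, rfl, he⟩ := exists_expr hn
  rw [← he]
  exact e.one_le_ones

theorem complexity_one : complexity 1 = 1 :=
  le_antisymm (complexity_value_le .one) (one_le_complexity le_rfl)

theorem complexity_add_le {a b : ℕ} (ha : 1 ≤ a) (hb : 1 ≤ b) :
    complexity (a + b) ≤ complexity a + complexity b := by
  obtain ⟨e, rfl, he⟩ := exists_expr ha
  obtain ⟨f, rfl, hf⟩ := exists_expr hb
  rw [← he, ← hf]
  exact complexity_value_le (.add e f)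

theorem complexity_mul_le {a b : ℕ} (ha : 1 ≤ a) (hb : 1 ≤ b) :
    complexity (a * b) ≤ complexity a + complexity b := by
  obtain ⟨e, rfl, he⟩ := exists_expr ha
  obtain ⟨f, rfl, hf⟩ := exists_expr hb
  rw [← he, ← hf]
  exact complexity_value_le (.mul e f)

/-- The last operation of a shortest expression of `n ≥ 2` is a sum, which may be taken with its
smaller summand second, or a product of two nontrivial factors. -/
theorem exists_efficient_decomposition {n : ℕ} (hn : 2 ≤ n) :
    (∃ a b, 1 ≤ b ∧ b ≤ a ∧ n = a + b ∧ complexity n = complexity a + complexity b) ∨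
    (∃ a b, 2 ≤ a ∧ 2 ≤ b ∧ n = a * b ∧ complexity n = complexity a + complexity b) := by
  obtain ⟨e, he, hc⟩ := exists_expr (show 1 ≤ n by omega)
  cases e with
  | one => simp [Expr.value] at he; omega
  | add f g =>
    left
    simp only [Expr.value] at he
    simp only [Expr.ones] at hc
    have hf := complexity_value_le f
    have hg := complexity_value_le g
    have h := complexity_add_le f.one_le_value g.one_le_value
    rw [he] at h
    rcases le_total g.value f.value with hl | hl
    · exact ⟨_, _, g.one_le_value, hl, he.symm, by omega⟩
    · exact ⟨_, _, f.one_le_value, hl, by omega, by omega⟩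
  | mul f g =>
    right
    simp only [Expr.value] at he
    simp only [Expr.ones] at hc
    have hf := complexity_value_le f
    have hg := complexity_value_le g
    have h := complexity_mul_le f.one_le_value g.one_le_value
    rw [he] at h
    have hf1 := f.one_le_value
    have hg1 := g.one_le_value
    have hf2 := f.one_le_ones
    have hg2 := g.one_le_ones
    refine ⟨_, _, ?_, ?_, he.symm, by omega⟩
    · by_contra hlt
      rw [show f.value = 1 by omega, one_mul] at he
      rw [he] at hg
      omega
    · by_contra hlt
      rw [show g.value = 1 by omega, mul_one] at he
      rw [he] at hf
      omega

theorem complexity_three : complexity 3 = 3 := by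
  refine le_antisymm (complexity_value_le (.add (.add .one .one) .one)) ?_
  exact (Nat.pow_le_pow_iff_right (by norm_num)).1 (cube_le_pow_complexity (n := 3) (by norm_num))

theorem complexity_two : complexity 2 = 2 := by
  refine le_antisymm (complexity_value_le (.add .one .one)) ?_
  by_contra h
  have h1 := one_le_complexity (n := 2) (by norm_num)
  have h2 := cube_le_pow_complexity (n := 2) (by norm_num)
  rw [show complexity 2 = 1 by omega] at h2
  norm_num at h2

theorem complexity_three_pow_mul_le {n : ℕ} (hn : 1 ≤ n) (k : ℕ) :
    complexity (3 ^ k * n) ≤ 3 * k + complexity n := by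
  induction k with
  | zero => simp
  | succ k ih =>
    have h := complexity_mul_le (a := 3) (b := 3 ^ k * n) (by norm_num)
      (Nat.mul_pos (by positivity) hn)
    rw [← mul_assoc, ← pow_succ', complexity_three] at h
    omega

theorem complexity_three_pow {k : ℕ} (hk : 1 ≤ k) : complexity (3 ^ k) = 3 * k := by
  obtain ⟨j, rfl⟩ := Nat.exists_eq_succ_of_ne_zero (show k ≠ 0 by omega)
  refine le_antisymm ?_ ?_
  · have := complexity_three_pow_mul_le (n := 3) (by norm_num) j
    rw [← pow_succ, complexity_three] at this
    simp only [Nat.succ_eq_add_one]; omega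
  · have := cube_le_pow_complexity (n := 3 ^ (j + 1)) (Nat.one_le_pow _ _ (by norm_num))
    rw [← pow_mul] at this
    have := (Nat.pow_le_pow_iff_right (by norm_num)).1 this
    simp only [Nat.succ_eq_add_one]; omega

theorem three_logb_le_iff {x : ℝ} (hx : 0 < x) {c : ℕ} :
    3 * Real.logb 3 x ≤ c ↔ x ^ 3 ≤ 3 ^ c := by
  rw [← Real.rpow_natCast 3 c, ← Real.logb_le_iff_le_rpow (by norm_num) (by positivity),
    Real.logb_pow]
  norm_num

theorem defect_nonneg {n : ℕ} (hn : 1 ≤ n) : 0 ≤ defect n := by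
  have h := (three_logb_le_iff (x := n) (by exact_mod_cast hn) (c := complexity n)).2
    (by exact_mod_cast cube_le_pow_complexity hn)
  unfold defect
  linarith

theorem logb_mul_nat {a b : ℕ} (ha : 1 ≤ a) (hb : 1 ≤ b) :
    Real.logb 3 ((a * b : ℕ) : ℝ) = Real.logb 3 a + Real.logb 3 b := by
  rw [Nat.cast_mul, Real.logb_mul (by positivity) (by positivity)]

/-- The factors of an efficient product have defects adding up to that of the product. -/
theorem defect_mul_of_efficient {a b : ℕ} (ha : 1 ≤ a) (hb : 1 ≤ b)
    (h : complexity (a * b) = complexity a + complexity b) :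
    defect (a * b) = defect a + defect b := by
  unfold defect
  rw [logb_mul_nat ha hb, h]
  push_cast
  ring

theorem defect_add_of_efficient {a b : ℕ} (ha : 1 ≤ a)
    (h : complexity (a + b) = complexity a + complexity b) :
    defect (a + b) = defect a + complexity b - 3 * Real.logb 3 (1 + (b : ℝ) / a) := by
  have : ((a + b : ℕ) : ℝ) = a * (1 + (b : ℝ) / a) := by
    have : (a : ℝ) ≠ 0 := by positivity
    push_cast; field_simp
  unfold defect
  rw [this, Real.logb_mul (by positivity) (by positivity), h]
  push_cast
  ring

theorem defect_three_pow_mul {n : ℕ} (hn : 1 ≤ n) (k : ℕ) :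
    defect (3 ^ k * n) = complexity (3 ^ k * n) - 3 * k - complexity n + defect n := by
  unfold defect
  rw [logb_mul_nat (Nat.one_le_pow _ _ (by norm_num)) hn]
  push_cast
  rw [Real.logb_pow, Real.logb_self_eq_one (by norm_num)]
  ring

theorem defect_three_pow_mul_le {n : ℕ} (hn : 1 ≤ n) (k : ℕ) :
    defect (3 ^ k * n) ≤ defect n := by
  rw [defect_three_pow_mul hn]
  have : (complexity (3 ^ k * n) : ℝ) ≤ 3 * k + complexity n := by
    exact_mod_cast complexity_three_pow_mul_le hn k
  linarith

theorem IsStable.defect_three_pow_mul {n : ℕ} (hs : IsStable n) (hn : 1 ≤ n) (k : ℕ) :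
    defect (3 ^ k * n) = defect n := by
  rcases Nat.eq_zero_or_pos k with rfl | hk
  · simp
  · rw [IntegerComplexity.defect_three_pow_mul hn, hs k hk]
    push_cast; ring

theorem defect_three_pow {k : ℕ} (hk : 1 ≤ k) : defect (3 ^ k) = 0 := by
  unfold defect
  rw [complexity_three_pow hk]
  push_cast
  rw [Real.logb_pow, Real.logb_self_eq_one (by norm_num)]
  ring

theorem defect_three : defect 3 = 0 := by simpa using defect_three_pow (k := 1) le_rfl

theorem defect_one : defect 1 = 1 := by simp [defect, complexity_one]

/-- Every positive integer becomes stable after multiplication by a power of `3`. -/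
theorem exists_isStable_three_pow_mul {n : ℕ} (hn : 1 ≤ n) : ∃ k, IsStable (3 ^ k * n) := by
  have hlow : ∀ k, 3 * k ≤ complexity (3 ^ k * n) := fun k => by
    have h1 : (3 ^ k) ^ 3 ≤ (3 ^ k * n) ^ 3 := Nat.pow_le_pow_left (Nat.le_mul_of_pos_right _ hn) 3
    have h2 := h1.trans (cube_le_pow_complexity (Nat.mul_pos (by positivity) hn))
    rw [← pow_mul] at h2
    have := (Nat.pow_le_pow_iff_right (by norm_num)).1 h2
    omega
  -- the shift `‖3 ^ k * n‖ - 3 * k` is nonincreasing in `k`; take `k` where it is least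
  obtain ⟨k, hk⟩ := exists_minimalFor_of_wellFoundedLT (fun _ : ℕ => True)
    (fun k => complexity (3 ^ k * n) - 3 * k) ⟨0, trivial⟩
  refine ⟨k, fun j hj => ?_⟩
  have h1 := complexity_three_pow_mul_le (n := 3 ^ k * n) (Nat.mul_pos (by positivity) hn) j
  have h2 := hk.2 (j := j + k) trivial
  have h3 := hlow (j + k)
  have h4 := hlow k
  simp only [pow_add, mul_assoc] at h2 h3
  omega

/-- Defects that differ by an integer belong to integers whose quotient is a power of `3`. -/
theorem eq_three_pow_mul_of_defect_sub_int {m n : ℕ} (hm : 1 ≤ m) (hn : 1 ≤ n) {r : ℤ}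
    (h : defect n = defect m + r) : (∃ k, m = 3 ^ k * n) ∨ (∃ k, n = 3 ^ k * m) := by
  wlog hle : n ≤ m generalizing m n r
  · exact (this hn hm (r := -r) (by push_cast; linarith) (by omega)).symm
  left
  have hm' : (0 : ℝ) < m := by exact_mod_cast hm
  have hn' : (0 : ℝ) < n := by exact_mod_cast hn
  have h1 : 3 * (Real.logb 3 m - Real.logb 3 n) = (r + complexity m - complexity n : ℤ) := by
    unfold defect at h
    push_cast
    linarith
  have h0 : 0 ≤ Real.logb 3 m - Real.logb 3 n :=
    sub_nonneg.2 (Real.logb_le_logb_of_le (by norm_num) hn' (by exact_mod_cast hle))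
  obtain ⟨t, ht⟩ : ∃ t : ℕ, (r + complexity m - complexity n : ℤ) = t :=
    Int.eq_ofNat_of_zero_le (by rw [← Int.cast_nonneg_iff (R := ℝ), ← h1]; linarith)
  rw [ht] at h1
  have h2 : (m : ℝ) ^ 3 = 3 ^ t * n ^ 3 := by
    have h3 : Real.logb 3 ((m : ℝ) ^ 3) = Real.logb 3 (3 ^ t * n ^ 3) := by
      rw [Real.logb_mul (by positivity) (by positivity), Real.logb_pow, Real.logb_pow,
        Real.logb_pow, Real.logb_self_eq_one (by norm_num)]
      push_cast at h1 ⊢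
      linarith
    exact Real.logb_injOn_pos (b := 3) (by norm_num)
      (show (0 : ℝ) < (m : ℝ) ^ 3 by positivity)
      (show (0 : ℝ) < 3 ^ t * (n : ℝ) ^ 3 by positivity) h3
  have h2' : m ^ 3 = 3 ^ t * n ^ 3 := by exact_mod_cast h2
  have hdvd : n ∣ m := (Nat.pow_dvd_pow_iff (by norm_num : (3 : ℕ) ≠ 0)).1 ⟨3 ^ t, by linarith⟩
  obtain ⟨q, rfl⟩ := hdvd
  have h4 : q ^ 3 = 3 ^ t := by
    rw [mul_pow, mul_comm] at h2'
    exact Nat.eq_of_mul_eq_mul_right (by positivity) h2'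
  obtain ⟨k, -, hk⟩ := (Nat.dvd_prime_pow Nat.prime_three).1
    (h4 ▸ dvd_pow_self q (by norm_num) : q ∣ 3 ^ t)
  exact ⟨k, by rw [hk, mul_comm]⟩

/-- No defect of a stable number exceeds another defect by a positive integer. -/
theorem IsStable.not_defect_eq_add {m n : ℕ} (hs : IsStable n) (hm : 1 ≤ m) (hn : 1 ≤ n)
    {r : ℤ} (hr : 1 ≤ r) : defect n ≠ defect m + r := by
  intro h
  have hr' : (1 : ℝ) ≤ r := by exact_mod_cast hr
  rcases eq_three_pow_mul_of_defect_sub_int hm hn h with ⟨k, rfl⟩ | ⟨k, rfl⟩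
  · rw [hs.defect_three_pow_mul hn] at h
    linarith
  · linarith [defect_three_pow_mul_le hm k]

/-- Equal defects belong to integers of congruent complexities. -/
theorem complexity_cast_eq_of_defect_eq {m n : ℕ} (hm : 1 ≤ m) (hn : 1 ≤ n)
    (h : defect n = defect m) : (complexity n : ZMod 3) = complexity m := by
  wlog hmn : ∃ k, m = 3 ^ k * n generalizing m n
  · rcases eq_three_pow_mul_of_defect_sub_int hm hn (r := 0) (by simpa using h) with h' | h'
    · exact this hm hn h h'
    · exact (this hn hm h.symm h').symm
  obtain ⟨k, rfl⟩ := hmn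
  have h1 := defect_three_pow_mul hn k
  have h2 : complexity (3 ^ k * n) = 3 * k + complexity n := by
    have : (complexity (3 ^ k * n) : ℝ) = 3 * k + complexity n := by linarith
    exact_mod_cast this
  rw [h2]
  push_cast
  rw [show (3 : ZMod 3) = 0 from rfl]
  simp

/-- The only integral defects are `δ(1) = 1` and `δ(3 ^ k) = 0` for `k ≥ 1`. -/
theorem defect_eq_nat {n k : ℕ} (hn : 1 ≤ n) (h : defect n = k) : n = 1 ∨ k = 0 := by
  have hk : defect n = defect 1 + ((k : ℤ) - 1 : ℤ) := by rw [h, defect_one]; push_cast; ring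
  have : ∃ j, n = 3 ^ j := by
    rcases eq_three_pow_mul_of_defect_sub_int le_rfl hn hk with ⟨j, hj⟩ | ⟨j, hj⟩
    · exact ⟨0, by simpa using Nat.eq_one_of_mul_eq_one_left hj.symm⟩
    · exact ⟨j, by simpa using hj⟩
  obtain ⟨j, rfl⟩ := this
  rcases Nat.eq_zero_or_pos j with rfl | hj
  · left; simp
  · right
    rw [defect_three_pow hj] at h
    exact_mod_cast h.symm

theorem isStable_three : IsStable 3 := by
  intro k _
  rw [← pow_succ, complexity_three_pow (by omega), complexity_three]
  ring

theorem not_isStable_one : ¬ IsStable 1 := by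
  intro h
  have := h 1 le_rfl
  norm_num [complexity_three, complexity_one] at this

/-- There is a gap above the defect `0`. -/
theorem defect_eq_zero_or_le {n : ℕ} (hn : 1 ≤ n) : defect n = 0 ∨ 1 / 10 ≤ defect n := by
  -- because `2 ^ 30 ≤ 3 ^ 19`
  have hlog2 : 3 * Real.logb 3 2 ≤ 19 / 10 := by
    have h := (Real.logb_le_iff_le_rpow (b := 3) (x := 2 ^ 30) (y := (19 : ℕ)) (by norm_num)
      (by norm_num)).2 (by rw [Real.rpow_natCast]; norm_num)
    rw [Real.logb_pow] at h
    push_cast at h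
    linarith
  induction n using Nat.strong_induction_on with
  | _ n ih =>
  rcases Nat.lt_or_ge n 2 with h2 | h2
  · obtain rfl : n = 1 := by omega
    rw [defect_one]; norm_num
  rcases exists_efficient_decomposition h2 with ⟨a, b, hb, hba, rfl, hc⟩ | ⟨a, b, ha, hb, rfl, hc⟩
  · have ha : 1 ≤ a := hb.trans hba
    have haR : (0 : ℝ) < a := by exact_mod_cast ha
    have hd := defect_add_of_efficient ha hc
    have hda := defect_nonneg ha
    have hlog : 3 * Real.logb 3 (1 + (b : ℝ) / a) ≤ 19 / 10 := by
      refine le_trans ?_ hlog2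
      gcongr
      · norm_num
      · have : (b : ℝ) / a ≤ 1 := (div_le_one haR).2 (by exact_mod_cast hba)
        linarith
    rcases Nat.lt_or_ge b 2 with hb2 | hb2
    · obtain rfl : b = 1 := by omega
      rcases Nat.lt_or_ge a 3 with ha3 | ha3
      · interval_cases a
        · right
          have : defect (1 + 1) = 2 - 3 * Real.logb 3 2 := by simp [defect, complexity_two]
          rw [this]; linarith
        · left
          exact defect_three
      · right
        have : Real.logb 3 (1 + ((1 : ℕ) : ℝ) / a) ≤ 3 / 10 := by
          have h1 : 1 + ((1 : ℕ) : ℝ) / a ≤ 4 / 3 := by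
            have : (1 : ℝ) / a ≤ 1 / 3 := by
              apply one_div_le_one_div_of_le (by norm_num); exact_mod_cast ha3
            push_cast; linarith
          have h2 : Real.logb 3 (4 / 3) ≤ 3 / 10 := by
            have h := (Real.logb_le_iff_le_rpow (b := 3) (x := (4 / 3) ^ 10) (y := (3 : ℕ))
              (by norm_num) (by norm_num)).2 (by rw [Real.rpow_natCast]; norm_num)
            rw [Real.logb_pow] at h
            push_cast at h
            linarith
          exact (Real.logb_le_logb_of_le (by norm_num) (by positivity) h1).trans h2
        rw [hd, complexity_one]
        push_cast at this ⊢
        linarith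
    · right
      have : 2 ≤ complexity b := by
        by_contra hlt
        have h1 := cube_le_pow_complexity hb
        have h3 : 3 ^ complexity b ≤ 3 ^ 1 := Nat.pow_le_pow_right (by norm_num) (by omega)
        have h4 : 2 ^ 3 ≤ b ^ 3 := Nat.pow_le_pow_left hb2 3
        omega
      have : (2 : ℝ) ≤ complexity b := by exact_mod_cast this
      rw [hd]; linarith
  · rw [defect_mul_of_efficient (by omega) (by omega) hc]
    have ha0 := defect_nonneg (n := a) (by omega)
    have hb0 := defect_nonneg (n := b) (by omega)
    rcases ih a (by nlinarith) (by omega) with h | h <;>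
    rcases ih b (by nlinarith) (by omega) with h' | h'
    · left; linarith
    all_goals right; linarith

/-! ### Limits of defects along ultrafilters -/

/-- The set of all `δ(m) + r` with `m ≥ 1` and a natural number `r`. It is the value set of
`N - 3 log₃ m` for `N ≥ ‖m‖`, so of "defects" computed from possibly wasteful expressions. -/
def shiftedDefectSet : Set ℝ :=
  {x | ∃ m r : ℕ, 1 ≤ m ∧ x = defect m + r}

theorem defect_mem_shiftedDefectSet {n : ℕ} (hn : 1 ≤ n) : defect n ∈ shiftedDefectSet :=
  ⟨n, 0, hn, by simp⟩

theorem shiftedDefectSet_nonneg {x : ℝ} (hx : x ∈ shiftedDefectSet) : 0 ≤ x := by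
  obtain ⟨m, r, hm, rfl⟩ := hx
  have := defect_nonneg hm
  positivity

theorem zero_mem_shiftedDefectSet : (0 : ℝ) ∈ shiftedDefectSet :=
  ⟨3, 0, by norm_num, by simp [defect_three]⟩

theorem add_natCast_mem_shiftedDefectSet {x : ℝ} (hx : x ∈ shiftedDefectSet) (c : ℕ) :
    x + c ∈ shiftedDefectSet := by
  obtain ⟨m, r, hm, rfl⟩ := hx
  exact ⟨m, r + c, hm, by push_cast; ring⟩

theorem add_mem_shiftedDefectSet {x y : ℝ} (hx : x ∈ shiftedDefectSet)
    (hy : y ∈ shiftedDefectSet) : x + y ∈ shiftedDefectSet := by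
  obtain ⟨m, r, hm, rfl⟩ := hx
  obtain ⟨n, s, hn, rfl⟩ := hy
  have h := complexity_mul_le hm hn
  refine ⟨m * n, r + s + (complexity m + complexity n - complexity (m * n)),
    Nat.mul_pos hm hn, ?_⟩
  unfold defect
  rw [logb_mul_nat hm hn]
  push_cast [h]
  ring

theorem mem_shiftedDefectSet_of_sub_one {x : ℝ} (hx : x - 1 ∈ shiftedDefectSet) :
    x ∈ shiftedDefectSet := by
  simpa using add_natCast_mem_shiftedDefectSet hx 1

/-- Along the ultrafilter `F`, the function `g` is eventually equal to an element of
`shiftedDefectSet`, or it converges, strictly from below, to an element of that set plus `1`. -/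
def HasDefectLimit {α : Type} (F : Ultrafilter α) (g : α → ℝ) : Prop :=
  (∃ z ∈ shiftedDefectSet, ∀ᶠ x in F, g x = z) ∨
  (∃ z, z - 1 ∈ shiftedDefectSet ∧ Tendsto g F (𝓝[<] z))

theorem tendsto_nhdsLT_iff {α : Type} {F : Filter α} {g : α → ℝ} {z : ℝ} :
    Tendsto g F (𝓝[<] z) ↔ Tendsto g F (𝓝 z) ∧ ∀ᶠ x in F, g x < z :=
  tendsto_nhdsWithin_iff

theorem HasDefectLimit.exists_tendsto {α : Type} {F : Ultrafilter α} {g : α → ℝ}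
    (h : HasDefectLimit F g) :
    ∃ z ∈ shiftedDefectSet, Tendsto g F (𝓝 z) ∧ ∀ᶠ x in F, g x ≤ z := by
  rcases h with ⟨z, hz, h⟩ | ⟨z, hz, h⟩
  · exact ⟨z, hz, tendsto_const_nhds.congr' (h.mono fun _ hx => hx.symm), h.mono fun _ hx => hx.le⟩
  · rw [tendsto_nhdsLT_iff] at h
    exact ⟨z, mem_shiftedDefectSet_of_sub_one hz, h.1, h.2.mono fun _ hx => hx.le⟩

theorem HasDefectLimit.congr {α : Type} {F : Ultrafilter α} {g h : α → ℝ}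
    (hg : HasDefectLimit F g) (hgh : ∀ᶠ x in F, g x = h x) : HasDefectLimit F h := by
  rcases hg with ⟨z, hz, hg⟩ | ⟨z, hz, hg⟩
  · refine Or.inl ⟨z, hz, ?_⟩
    filter_upwards [hg, hgh] with x h1 h2
    rw [← h2, h1]
  · exact Or.inr ⟨z, hz, hg.congr' hgh⟩

theorem HasDefectLimit.add {α : Type} {F : Ultrafilter α} {g h : α → ℝ}
    (hg : HasDefectLimit F g) (hh : HasDefectLimit F h) :
    HasDefectLimit F (fun x => g x + h x) := by
  wlog hlt : ∃ z, z - 1 ∈ shiftedDefectSet ∧ Tendsto g F (𝓝[<] z) generalizing g h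
  · rcases hg with ⟨z, hz, hg⟩ | hg
    · rcases hh with ⟨w, hw, hh⟩ | hh
      · refine Or.inl ⟨z + w, add_mem_shiftedDefectSet hz hw, ?_⟩
        filter_upwards [hg, hh] with x h1 h2
        rw [h1, h2]
      · exact (this (Or.inr hh) (Or.inl ⟨z, hz, hg⟩) hh).congr
          (Eventually.of_forall fun x => add_comm _ _)
    · exact absurd hg hlt
  obtain ⟨z, hz, hg⟩ := hlt
  obtain ⟨w, hw, hw1, hw2⟩ := hh.exists_tendsto
  rw [tendsto_nhdsLT_iff] at hg
  refine Or.inr ⟨z + w, ?_, tendsto_nhdsLT_iff.2 ⟨hg.1.add hw1, ?_⟩⟩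
  · rw [show z + w - 1 = z - 1 + w by ring]
    exact add_mem_shiftedDefectSet hz hw
  · filter_upwards [hg.2, hw2] with x h1 h2
    linarith

/-- A positive integer minus a positive null function can be added to `g`, whether `g` is eventually
constant or not. -/
theorem HasDefectLimit.add_nat_sub {α : Type} {F : Ultrafilter α} {g ε : α → ℝ}
    (hg : HasDefectLimit F g) {c : ℕ} (hc : 1 ≤ c) (hε : Tendsto ε F (𝓝[>] 0)) :
    HasDefectLimit F (fun x => g x + c - ε x) := by
  obtain ⟨w, hw, hw1, hw2⟩ := hg.exists_tendsto
  obtain ⟨hε1, hε2⟩ := tendsto_nhdsWithin_iff.1 hε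
  refine Or.inr ⟨w + c, ?_, tendsto_nhdsLT_iff.2 ⟨?_, ?_⟩⟩
  · obtain ⟨d, rfl⟩ := Nat.exists_eq_add_of_le hc
    rw [show w + ((1 + d : ℕ) : ℝ) - 1 = w + d by push_cast; ring]
    exact add_natCast_mem_shiftedDefectSet hw d
  · simpa using (hw1.add_const (c : ℝ)).sub hε1
  · filter_upwards [hw2, hε2] with x h1 h2
    have : 0 < ε x := h2
    linarith

/-- A bounded function to `ℕ` is eventually constant along an ultrafilter. -/
theorem eventually_eq_of_eventually_le {α : Type} {F : Ultrafilter α} {f : α → ℕ} {B : ℕ}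
    (h : ∀ᶠ x in F, f x ≤ B) : ∃ c, ∀ᶠ x in F, f x = c := by
  have h' : ∀ᶠ x in F, ∃ c ∈ Set.Iic B, f x = c := h.mono fun x hx => ⟨f x, hx, rfl⟩
  obtain ⟨c, -, hc⟩ := (Ultrafilter.eventually_exists_mem_iff (Set.finite_Iic B)).1 h'
  exact ⟨c, hc⟩

/-- A function to `ℕ` is eventually constant or tends to infinity along an ultrafilter. -/
theorem eventually_eq_or_tendsto_atTop {α : Type} (F : Ultrafilter α) (f : α → ℕ) :
    (∃ c, ∀ᶠ x in F, f x = c) ∨ Tendsto f F atTop := by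
  by_cases h : ∃ B, ∀ᶠ x in F, f x ≤ B
  · obtain ⟨B, hB⟩ := h
    exact Or.inl (eventually_eq_of_eventually_le hB)
  · right
    simp only [not_exists, not_eventually, not_le] at h
    refine tendsto_atTop.2 fun B => ?_
    filter_upwards [Ultrafilter.frequently_iff_eventually.1 (h B)] with x hx
    exact hx.le

theorem tendsto_logb_one_add_div {α : Type} {F : Filter α} {f : α → ℕ} (hf : Tendsto f F atTop)
    {b : ℕ} (hb : 1 ≤ b) :
    Tendsto (fun x => 3 * Real.logb 3 (1 + (b : ℝ) / f x)) F (𝓝[>] 0) := by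
  refine tendsto_nhdsWithin_iff.2 ⟨?_, ?_⟩
  · have h1 : Tendsto (fun x => 1 + (b : ℝ) / f x) F (𝓝 (1 + 0)) :=
      tendsto_const_nhds.add
        (tendsto_const_nhds.div_atTop (tendsto_natCast_atTop_atTop.comp hf))
    have h2 := (Real.continuousAt_logb (b := 3) (x := 1 + 0) (by norm_num)).tendsto.comp h1
    simpa using h2.const_mul 3
  · filter_upwards [hf.eventually_ge_atTop 1] with x hx
    have hx' : (0 : ℝ) < f x := by exact_mod_cast hx
    have hb' : (0 : ℝ) < b := by exact_mod_cast hb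
    have : 0 < Real.logb 3 (1 + (b : ℝ) / f x) :=
      Real.logb_pos (by norm_num) (by have := div_pos hb' hx'; linarith)
    exact Set.mem_Ioi.2 (by positivity)

theorem hasDefectLimit_of_eventually_eq {α : Type} {F : Ultrafilter α} {f : α → ℕ} {c : ℕ}
    (hf1 : ∀ᶠ x in F, 1 ≤ f x) (h : ∀ᶠ x in F, f x = c) :
    HasDefectLimit F (fun x => defect (f x)) := by
  obtain ⟨x, h1, h2⟩ := (hf1.and h).exists
  exact Or.inl ⟨defect c, defect_mem_shiftedDefectSet (h2 ▸ h1),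
    h.mono fun x hx => congrArg defect hx⟩

/-- Efficient sums `a + b` of bounded defect: the smaller summand `b` is bounded, and if `a` is
unbounded then the defect of `a` is smaller by almost `‖b‖ ≥ 1`. -/
theorem hasDefectLimit_of_efficient_add {α : Type} {F : Ultrafilter α} {s : ℝ} {f a b : α → ℕ}
    (ih : ∀ f : α → ℕ, (∀ᶠ x in F, 1 ≤ f x ∧ defect (f x) ≤ s) →
      HasDefectLimit F (fun x => defect (f x)))
    (hs : ∀ᶠ x in F, defect (f x) ≤ s + 1 / 20)
    (h : ∀ᶠ x in F, 1 ≤ b x ∧ b x ≤ a x ∧ f x = a x + b x ∧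
      complexity (f x) = complexity (a x) + complexity (b x)) :
    HasDefectLimit F (fun x => defect (f x)) := by
  have hd : ∀ᶠ x in F, defect (f x) =
      defect (a x) + complexity (b x) - 3 * Real.logb 3 (1 + (b x : ℝ) / a x) := by
    filter_upwards [h] with x ⟨h1, h2, h3, h4⟩
    rw [h3] at h4 ⊢
    exact defect_add_of_efficient (h1.trans h2) h4
  obtain ⟨B, hB⟩ := exists_nat_ge (s + 1 / 20 + 3 * Real.logb 3 2)
  obtain ⟨β, hβ⟩ : ∃ β, ∀ᶠ x in F, b x = β := by
    apply eventually_eq_of_eventually_le (B := 3 ^ B)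
    filter_upwards [h, hd, hs] with x ⟨h1, h2, h3, h4⟩ hd hs
    have ha : (0 : ℝ) < a x := by exact_mod_cast h1.trans h2
    have h5 : Real.logb 3 (1 + (b x : ℝ) / a x) ≤ Real.logb 3 2 := by
      refine Real.logb_le_logb_of_le (by norm_num) (by positivity) ?_
      have := (div_le_one ha).2 (by exact_mod_cast h2 : (b x : ℝ) ≤ a x)
      linarith
    have h6 := defect_nonneg (h1.trans h2)
    have h7 : complexity (b x) ≤ B := by
      have : (complexity (b x) : ℝ) ≤ B := by linarith
      exact_mod_cast this
    calc b x ≤ b x ^ 3 := Nat.le_self_pow (by norm_num) _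
      _ ≤ 3 ^ complexity (b x) := cube_le_pow_complexity h1
      _ ≤ 3 ^ B := Nat.pow_le_pow_right (by norm_num) h7
  have hβ1 : 1 ≤ β := by
    obtain ⟨x, h1, h2⟩ := (h.and hβ).exists
    exact h2 ▸ h1.1
  rcases eventually_eq_or_tendsto_atTop F a with ⟨c, hc⟩ | hinf
  · refine hasDefectLimit_of_eventually_eq (c := c + β) (h.mono fun x hx => by omega) ?_
    filter_upwards [h, hβ, hc] with x h1 h2 h3
    rw [h1.2.2.1, h2, h3]
  · have hε := tendsto_logb_one_add_div hinf hβ1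
    have ha : HasDefectLimit F (fun x => defect (a x)) := by
      apply ih
      have hε' := (tendsto_nhdsWithin_iff.1 hε).1.eventually_le_const
        (show (0 : ℝ) < 19 / 20 by norm_num)
      filter_upwards [h, hd, hs, hβ, hε'] with x h1 hd hs h2 h3
      refine ⟨h1.1.trans h1.2.1, ?_⟩
      have : (1 : ℝ) ≤ complexity (b x) := by exact_mod_cast one_le_complexity h1.1
      rw [h2] at hd this
      linarith
    refine (ha.add_nat_sub (one_le_complexity hβ1) hε).congr ?_
    filter_upwards [hd, hβ] with x h1 h2
    rw [h1, h2]

/-- The least positive integer with the same defect as `n`. -/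
noncomputable def leader (n : ℕ) : ℕ :=
  sInf {m | 1 ≤ m ∧ defect m = defect n}

theorem leader_spec {n : ℕ} (hn : 1 ≤ n) : 1 ≤ leader n ∧ defect (leader n) = defect n :=
  Nat.sInf_mem (s := {m | 1 ≤ m ∧ defect m = defect n}) ⟨n, hn, rfl⟩

theorem leader_le {m n : ℕ} (hm : 1 ≤ m) (h : defect m = defect n) : leader n ≤ m :=
  Nat.sInf_le ⟨hm, h⟩

/-- Defects that stay below `N / 20` have defect limits. The induction on `N` works because an
efficient factorization of a leader splits its defect into two parts of size at least `1 / 10`. -/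
theorem hasDefectLimit_of_le_div {α : Type} (F : Ultrafilter α) (N : ℕ) (f : α → ℕ)
    (hf : ∀ᶠ x in F, 1 ≤ f x ∧ defect (f x) ≤ N / 20) :
    HasDefectLimit F (fun x => defect (f x)) := by
  induction N generalizing f with
  | zero =>
    refine Or.inl ⟨0, zero_mem_shiftedDefectSet, ?_⟩
    filter_upwards [hf] with x ⟨h1, h2⟩
    exact le_antisymm (by simpa using h2) (defect_nonneg h1)
  | succ N ih =>
    wlog hlead : ∀ᶠ x in F, leader (f x) = f x generalizing f
    · have hl : ∀ᶠ x in F, 1 ≤ leader (f x) ∧ defect (leader (f x)) = defect (f x) :=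
        hf.mono fun x hx => leader_spec hx.1
      refine (this (fun x => leader (f x)) ?_ ?_).congr (hl.mono fun x hx => hx.2)
      · filter_upwards [hf, hl] with x h1 h2
        exact ⟨h2.1, h2.2 ▸ h1.2⟩
      · filter_upwards [hl] with x hx
        refine le_antisymm (leader_le hx.1 rfl) ?_
        have := leader_spec hx.1
        exact leader_le this.1 (this.2.trans hx.2)
    have hcases : ∀ᶠ x in F, f x = 1 ∨
        ((∃ a b, 1 ≤ b ∧ b ≤ a ∧ f x = a + b ∧
          complexity (f x) = complexity a + complexity b) ∨
        (∃ a b, 2 ≤ a ∧ 2 ≤ b ∧ f x = a * b ∧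
          complexity (f x) = complexity a + complexity b)) := by
      filter_upwards [hf] with x hx
      rcases hx.1.eq_or_lt with h | h
      · exact Or.inl h.symm
      · exact Or.inr (exists_efficient_decomposition h)
    have hs : ∀ᶠ x in F, defect (f x) ≤ N / 20 + 1 / 20 := by
      filter_upwards [hf] with x hx
      have := hx.2
      push_cast at this
      linarith
    rw [Ultrafilter.eventually_or, Ultrafilter.eventually_or] at hcases
    rcases hcases with h | h | h
    · exact hasDefectLimit_of_eventually_eq (hf.mono fun x hx => hx.1) h
    · obtain ⟨a, ha⟩ := h.choice
      obtain ⟨b, hb⟩ := ha.choice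
      exact hasDefectLimit_of_efficient_add ih hs hb
    · obtain ⟨a, ha⟩ := h.choice
      obtain ⟨b, hb⟩ := ha.choice
      have key : ∀ᶠ x in F, defect (f x) = defect (a x) + defect (b x) ∧
          1 / 10 ≤ defect (a x) ∧ 1 / 10 ≤ defect (b x) := by
        filter_upwards [hb, hlead] with x ⟨ha2, hb2, hab, hc⟩ hl
        rw [hab] at hc hl ⊢
        have hd := defect_mul_of_efficient (by omega) (by omega) hc
        -- if a factor had defect `0`, the other one would be a smaller number of the same defect
        refine ⟨hd, ?_, ?_⟩
        · rcases defect_eq_zero_or_le (n := a x) (by omega) with h0 | h0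
          · have := leader_le (m := b x) (n := a x * b x) (by omega) (by rw [hd, h0, zero_add])
            nlinarith
          · exact h0
        · rcases defect_eq_zero_or_le (n := b x) (by omega) with h0 | h0
          · have := leader_le (m := a x) (n := a x * b x) (by omega) (by rw [hd, h0, add_zero])
            nlinarith
          · exact h0
      have h1 : HasDefectLimit F (fun x => defect (a x)) := by
        apply ih
        filter_upwards [hb, key, hs] with x h1 h2 h3
        exact ⟨by omega, by linarith⟩
      have h2 : HasDefectLimit F (fun x => defect (b x)) := by
        apply ih
        filter_upwards [hb, key, hs] with x h1 h2 h3
        exact ⟨by omega, by linarith⟩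
      exact (h1.add h2).congr (key.mono fun x hx => hx.1.symm)

/-- Any bounded family of elements of `shiftedDefectSet` has a defect limit. -/
theorem hasDefectLimit_of_eventually_le {α : Type} {F : Ultrafilter α} {g : α → ℝ} {B : ℝ}
    (hg : ∀ᶠ x in F, g x ∈ shiftedDefectSet) (hB : ∀ᶠ x in F, g x ≤ B) :
    HasDefectLimit F g := by
  obtain ⟨m, hm⟩ := hg.choice
  obtain ⟨r, hr⟩ := hm.choice
  obtain ⟨N, hN⟩ := exists_nat_ge (20 * B)
  obtain ⟨c, hc⟩ : ∃ c, ∀ᶠ x in F, r x = c := by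
    apply eventually_eq_of_eventually_le (B := N)
    filter_upwards [hr, hB] with x h1 h2
    have := defect_nonneg h1.1
    have h3 : (0 : ℝ) ≤ r x := by positivity
    have : (r x : ℝ) ≤ N := by linarith
    exact_mod_cast this
  have h1 : HasDefectLimit F (fun x => defect (m x)) := by
    apply hasDefectLimit_of_le_div F N
    filter_upwards [hr, hB] with x h1 h2
    have h3 : (0 : ℝ) ≤ r x := by positivity
    exact ⟨h1.1, by linarith⟩
  have h2 : HasDefectLimit F (fun _ => (c : ℝ)) :=
    Or.inl ⟨c, by simpa using add_natCast_mem_shiftedDefectSet zero_mem_shiftedDefectSet c,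
      Eventually.of_forall fun _ => rfl⟩
  refine (h1.add h2).congr ?_
  filter_upwards [hr, hc] with x h1 h2
  rw [h1.2, h2]

/-! ### Topology of the set of shifted defects -/

theorem isClosed_shiftedDefectSet : IsClosed shiftedDefectSet := by
  refine isClosed_iff_ultrafilter.2 fun x F hF hmem => ?_
  have hB : ∀ᶠ y in F, id y ≤ x + 1 := hF (Iic_mem_nhds (by linarith))
  obtain ⟨z, hz, hlim, -⟩ := (hasDefectLimit_of_eventually_le (g := id) hmem hB).exists_tendsto
  rwa [tendsto_nhds_unique (show Tendsto id (F : Filter ℝ) (𝓝 x) from hF) hlim]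

theorem isWF_shiftedDefectSet : shiftedDefectSet.IsWF := by
  rw [Set.isWF_iff_no_descending_seq]
  intro f hf hmem
  have hlt : ∀ n, ∀ᶠ k in (hyperfilter ℕ : Filter ℕ), f k < f n := fun n =>
    Nat.hyperfilter_le_atTop ((eventually_gt_atTop n).mono fun k hk => hf hk)
  rcases hasDefectLimit_of_eventually_le (F := hyperfilter ℕ) (Eventually.of_forall hmem)
    ((hlt 0).mono fun _ h => h.le) with ⟨z, -, h⟩ | ⟨z, -, h⟩
  · obtain ⟨n, hn⟩ := h.exists
    obtain ⟨k, h1, h2⟩ := ((hlt n).and h).exists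
    linarith
  · rw [tendsto_nhdsLT_iff] at h
    obtain ⟨n, hn⟩ := h.2.exists
    have := le_of_tendsto h.1 ((hlt n).mono fun _ h => h.le)
    linarith

/-- If `shiftedDefectSet` has infinitely many elements in `[w, z)`, then they accumulate at a point
`y + 1` of `(w, z]` with `y` again in the set. -/
theorem exists_mem_of_infinite_inter_Ico {w z : ℝ}
    (h : (shiftedDefectSet ∩ Set.Ico w z).Infinite) :
    ∃ y ∈ shiftedDefectSet, w - 1 < y ∧ y ≤ z - 1 := by
  let e := Set.Infinite.natEmbedding _ h
  have hmem : ∀ᶠ n in (hyperfilter ℕ : Filter ℕ), (e n : ℝ) ∈ shiftedDefectSet ∩ Set.Ico w z :=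
    Eventually.of_forall fun n => (e n).2
  rcases hasDefectLimit_of_eventually_le (hmem.mono fun _ h => h.1)
    (hmem.mono fun _ h => h.2.2.le) with ⟨y, -, hy⟩ | ⟨y, hy, hlim⟩
  · refine absurd hy (notMem_hyperfilter_of_finite (Set.Subsingleton.finite fun m hm n hn => ?_))
    exact e.injective (Subtype.ext (hm.trans hn.symm))
  · rw [tendsto_nhdsLT_iff] at hlim
    refine ⟨y - 1, hy, ?_, ?_⟩
    · obtain ⟨n, h1, h2⟩ := (hmem.and hlim.2).exists
      have := h1.2.1
      linarith
    · have := le_of_tendsto hlim.1 (hmem.mono fun _ h => h.2.2.le)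
      linarith

/-- The witnesses are multiples of `3 ^ j * m + 1`, for large `j`, by powers of `3` that make them
stable. The point is that their complexity is not smaller than expected: otherwise their defects
would accumulate at `δ(m) + e` for an integer `e ≤ 0`, which is not of the form `δ(m') + r` with
`r ≥ 1` since `m` is stable. -/
theorem IsStable.exists_isStable_defect_mem_Ioo {m : ℕ} (hs : IsStable m) (hm : 1 ≤ m) {y : ℝ}
    (hy : y < defect m + 1) :
    ∃ n, 1 ≤ n ∧ n ≠ 1 ∧ IsStable n ∧ (complexity n : ZMod 3) = complexity m + 1 ∧
      y < defect n ∧ defect n < defect m + 1 := by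
  have hpos : ∀ j, 1 ≤ 3 ^ j * m := fun j => Nat.mul_pos (by positivity) hm
  choose i hi using fun j => exists_isStable_three_pow_mul (n := 3 ^ j * m + 1) (by omega)
  set N : ℕ → ℕ := fun j => 3 ^ i j * (3 ^ j * m + 1) with hN
  have hN1 : ∀ j, 1 ≤ N j := fun j => Nat.mul_pos (by positivity) (by omega)
  set e : ℕ → ℤ := fun j => complexity (N j) - 3 * i j - 3 * j - complexity m with he
  set ε : ℕ → ℝ := fun j => 3 * Real.logb 3 (1 + ((1 : ℕ) : ℝ) / (3 ^ j * m : ℕ)) with hε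
  have he1 : ∀ j, e j ≤ 1 := fun j => by
    have h1 := complexity_three_pow_mul_le (n := 3 ^ j * m + 1) (by omega) (i j)
    have h2 := complexity_add_le (hpos j) le_rfl
    have h3 := complexity_three_pow_mul_le hm j
    rw [complexity_one] at h2
    simp only [he, hN]
    omega
  have hd : ∀ j, defect (N j) = defect m + e j - ε j := fun j => by
    have h1 : ((3 ^ j * m + 1 : ℕ) : ℝ) =
        3 ^ j * m * (1 + ((1 : ℕ) : ℝ) / (3 ^ j * m : ℕ)) := by
      have : (m : ℝ) ≠ 0 := by positivity
      push_cast; field_simp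
    simp only [he, hN, hε, defect]
    rw [logb_mul_nat (Nat.one_le_pow _ _ (by norm_num)) (by omega), h1,
      Real.logb_mul (by positivity) (by positivity), Real.logb_mul (by positivity) (by positivity)]
    push_cast
    rw [Real.logb_pow, Real.logb_pow, Real.logb_self_eq_one (by norm_num)]
    ring
  have hε0 : Tendsto ε atTop (𝓝[>] 0) := by
    refine tendsto_logb_one_add_div ?_ le_rfl
    refine tendsto_atTop_mono (fun j => ?_) tendsto_id
    exact (Nat.lt_pow_self (by norm_num)).le.trans (Nat.le_mul_of_pos_right _ hm)
  set F : Ultrafilter ℕ := hyperfilter ℕ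
  have hF : Tendsto ε F (𝓝[>] 0) := hε0.mono_left Nat.hyperfilter_le_atTop
  obtain ⟨hF1, hF2⟩ := tendsto_nhdsWithin_iff.1 hF
  rcases F.em (fun j => e j ≤ 0) with h | h
  · exfalso
    obtain ⟨B, hB⟩ := exists_nat_ge (defect m)
    have hfin : ∀ᶠ j in (F : Filter ℕ), ∃ c ∈ Set.Icc (-(B : ℤ)) 0, e j = c := by
      filter_upwards [h, hF2] with j h1 h2
      refine ⟨e j, ⟨?_, h1⟩, rfl⟩
      have h3 := defect_nonneg (hN1 j)
      have h4 : 0 < ε j := h2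
      have : (-(B : ℤ) : ℝ) ≤ e j := by push_cast; linarith [hd j]
      exact_mod_cast this
    obtain ⟨c, hc, hec⟩ := (Ultrafilter.eventually_exists_mem_iff (Set.finite_Icc _ _)).1 hfin
    have hlim : Tendsto (fun j => defect (N j)) F (𝓝 (defect m + c)) := by
      have h1 : Tendsto (fun j => defect m + c - ε j) F (𝓝 (defect m + c - 0)) :=
        tendsto_const_nhds.sub hF1
      rw [sub_zero] at h1
      refine h1.congr' ?_
      filter_upwards [hec] with j hj
      rw [hd, hj]
    have hlt : ∀ᶠ j in (F : Filter ℕ), defect (N j) < defect m + c := by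
      filter_upwards [hec, hF2] with j h1 h2
      have h4 : 0 < ε j := h2
      rw [hd, h1]
      linarith
    rcases hasDefectLimit_of_eventually_le
      (Eventually.of_forall fun j => defect_mem_shiftedDefectSet (hN1 j))
      (hlt.mono fun _ h => h.le) with ⟨z, -, hz⟩ | ⟨z, ⟨m', r, hm', hz⟩, hzlim⟩
    · have h1 : Tendsto (fun j => defect (N j)) F (𝓝 z) :=
        tendsto_const_nhds.congr' (hz.mono fun _ h => h.symm)
      obtain ⟨j, h2, h3⟩ := (hz.and hlt).exists
      rw [show defect (N j) = z from h2, tendsto_nhds_unique h1 hlim] at h3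
      exact lt_irrefl _ h3
    · have h1 := tendsto_nhds_unique (tendsto_nhdsLT_iff.1 hzlim).1 hlim
      refine hs.not_defect_eq_add hm' hm (r := r + 1 - c) (by have := hc.2; omega) ?_
      push_cast
      linarith
  · obtain ⟨j, h1, h2, h3⟩ :=
      (h.and (hF2.and (hF1.eventually_lt_const (sub_pos.2 hy)))).exists
    have he1j : e j = 1 := le_antisymm (he1 j) (by omega)
    have h4 : 0 < ε j := h2
    have hdj := hd j
    rw [he1j] at hdj
    push_cast at hdj
    refine ⟨N j, hN1 j, ?_, hi j, ?_, by linarith, by linarith⟩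
    · intro h5
      have := Nat.eq_one_of_mul_eq_one_left h5
      have := hpos j
      omega
    · have h5 : (complexity (N j) : ℤ) = 3 * (i j + j) + complexity m + 1 := by
        simp only [he] at he1j
        omega
      have h6 : complexity (N j) = 3 * (i j + j) + complexity m + 1 := by exact_mod_cast h5
      rw [h6]
      push_cast
      rw [show (3 : ZMod 3) = 0 from rfl]
      ring

/-- The residue class and the stability in the definition of `stableDefectSetMod` can be witnessed
by the same integer, since the defect determines the residue class of the complexity. -/
theorem mem_stableDefectSetMod_iff {a : ZMod 3} {x : ℝ} :
    x ∈ stableDefectSetMod a ↔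
      ∃ n, 1 ≤ n ∧ n ≠ 1 ∧ IsStable n ∧ (complexity n : ZMod 3) = a ∧ defect n = x := by
  constructor
  · rintro ⟨⟨n, hn, -, ha, rfl⟩, m, hm, hs, hmn⟩
    refine ⟨m, hm, ?_, hs, ?_, hmn⟩
    · rintro rfl
      exact not_isStable_one hs
    · rw [← ha, complexity_cast_eq_of_defect_eq hn hm hmn]
  · rintro ⟨n, hn, hn1, hs, ha, rfl⟩
    exact ⟨⟨n, hn, hn1, ha, rfl⟩, n, hn, hs, rfl⟩

theorem exists_mem_stableDefectSetMod_add_one {a : ZMod 3} {x y : ℝ}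
    (hx : x ∈ stableDefectSetMod a) (hy : y < x + 1) :
    ∃ z ∈ stableDefectSetMod (a + 1), y < z ∧ z < x + 1 := by
  obtain ⟨m, hm, -, hs, rfl, rfl⟩ := mem_stableDefectSetMod_iff.1 hx
  obtain ⟨n, hn, hn1, hns, hc, h1, h2⟩ := hs.exists_isStable_defect_mem_Ioo hm hy
  exact ⟨defect n, mem_stableDefectSetMod_iff.2 ⟨n, hn, hn1, hns, hc, rfl⟩, h1, h2⟩

/-! ### Order types of well-ordered sets of reals -/

open Classical in
/-- The order type of a well-ordered set of reals (and `0` if the set is not well-ordered). -/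
noncomputable def otype (S : Set ℝ) : Ordinal.{0} :=
  if _h : IsWellOrder S (fun x y => x < y) then Ordinal.type (fun x y : S => x < y) else 0

theorem isWellOrder_of_isWF {S : Set ℝ} (h : S.IsWF) : IsWellOrder S (fun x y => x < y) where
  wf := h
  trichotomous _ _ h1 h2 := le_antisymm (not_lt.1 h2) (not_lt.1 h1)

theorem otype_eq {S : Set ℝ} [h : IsWellOrder S (fun x y => x < y)] :
    otype S = Ordinal.type (fun x y : S => x < y) :=
  dif_pos h

theorem hasOrderType_of_otype_eq {S : Set ℝ} {o : Ordinal.{0}} (hS : S.IsWF) (h : otype S = o) :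
    HasOrderType S o := by
  have := isWellOrder_of_isWF hS
  exact ⟨this, by rw [← h, otype_eq]⟩

theorem otype_mono {S T : Set ℝ} (hT : T.IsWF) (hST : S ⊆ T) : otype S ≤ otype T := by
  have := isWellOrder_of_isWF hT
  have := isWellOrder_of_isWF (hT.mono hST)
  rw [otype_eq, otype_eq, Ordinal.type_le_iff']
  exact ⟨⟨⟨Set.inclusion hST, Set.inclusion_injective hST⟩, Iff.rfl⟩⟩

theorem otype_inter_Iio {S : Set ℝ} (hS : S.IsWF) [IsWellOrder S (fun x y => x < y)] (x : S) :
    otype (S ∩ Set.Iio x.1) = Ordinal.typein (fun x y : S => x < y) x := by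
  have := isWellOrder_of_isWF (hS.mono (Set.inter_subset_left (t := Set.Iio x.1)))
  rw [otype_eq, ← Ordinal.type_subrel]
  refine RelIso.ordinalType_congr ⟨⟨fun y => ⟨⟨y.1, y.2.1⟩, y.2.2⟩, fun y => ⟨y.1.1, y.1.2, y.2⟩,
    fun _ => rfl, fun _ => rfl⟩, Iff.rfl⟩

theorem exists_otype_inter_Iio_eq {S : Set ℝ} (hS : S.IsWF) {o : Ordinal.{0}}
    (ho : o < otype S) : ∃ x ∈ S, otype (S ∩ Set.Iio x) = o := by
  have := isWellOrder_of_isWF hS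
  rw [otype_eq] at ho
  obtain ⟨x, hx⟩ := Ordinal.typein_surj _ ho
  exact ⟨x, x.2, by rw [otype_inter_Iio hS x, ← hx]⟩

theorem otype_le_of_forall_lt {S : Set ℝ} (hS : S.IsWF) {o : Ordinal.{0}}
    (h : ∀ x ∈ S, otype (S ∩ Set.Iio x) < o) : otype S ≤ o := by
  by_contra hlt
  obtain ⟨x, hx, rfl⟩ := exists_otype_inter_Iio_eq hS (not_le.1 hlt)
  exact lt_irrefl _ (h x hx)

theorem otype_union {A B : Set ℝ} (h : (A ∪ B).IsWF) (hlt : ∀ a ∈ A, ∀ b ∈ B, a < b) :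
    otype (A ∪ B) = otype A + otype B := by
  classical
  have := isWellOrder_of_isWF h
  have := isWellOrder_of_isWF (h.mono Set.subset_union_left)
  have := isWellOrder_of_isWF (h.mono Set.subset_union_right)
  rw [otype_eq, otype_eq, otype_eq, ← Ordinal.type_sum_lex]
  have hdisj : Disjoint A B := Set.disjoint_left.2 fun x ha hb => lt_irrefl _ (hlt x ha x hb)
  symm
  refine RelIso.ordinalType_congr ⟨(Equiv.Set.union hdisj).symm, ?_⟩
  rintro (a | a) (b | b)
  · simp
  · simpa using hlt a a.2 b b.2
  · simpa using (hlt b b.2 a a.2).le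
  · simp

theorem otype_lt_omega0_iff {S : Set ℝ} (hS : S.IsWF) : otype S < ω ↔ S.Finite := by
  have := isWellOrder_of_isWF hS
  rw [otype_eq, ← Ordinal.card_lt_aleph0, Ordinal.card_type, Cardinal.lt_aleph0_iff_set_finite]

theorem otype_singleton (x : ℝ) : otype {x} = 1 := by
  have := isWellOrder_of_isWF (Set.finite_singleton x).isWF
  rw [otype_eq]
  exact Ordinal.type_eq_one_of_unique _

theorem otype_inter_Iio_eq_add {S : Set ℝ} (hS : S.IsWF) {w z : ℝ} (hwz : w ≤ z) :
    otype (S ∩ Set.Iio z) = otype (S ∩ Set.Iio w) + otype (S ∩ Set.Ico w z) := by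
  have h : S ∩ Set.Iio z = S ∩ Set.Iio w ∪ S ∩ Set.Ico w z := by
    rw [← Set.inter_union_distrib_left, Set.Iio_union_Ico_eq_Iio hwz]
  rw [h, otype_union (h ▸ hS.mono Set.inter_subset_left)]
  rintro a ⟨-, ha⟩ b ⟨-, hb⟩
  exact lt_of_lt_of_le ha hb.1

theorem otype_inter_Iic {S : Set ℝ} (hS : S.IsWF) {x : ℝ} (hx : x ∈ S) :
    otype (S ∩ Set.Iic x) = otype (S ∩ Set.Iio x) + 1 := by
  have h : S ∩ Set.Iic x = S ∩ Set.Iio x ∪ {x} := by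
    rw [← Set.Iio_union_right, Set.inter_union_distrib_left,
      Set.inter_eq_right.2 (Set.singleton_subset_iff.2 hx)]
  rw [h, otype_union (h ▸ hS.mono Set.inter_subset_left), otype_singleton]
  rintro a ⟨-, ha⟩ b rfl
  exact ha

theorem otype_inter_Iic_le {S : Set ℝ} (hS : S.IsWF) (x : ℝ) :
    otype (S ∩ Set.Iic x) ≤ otype (S ∩ Set.Iio x) + 1 := by
  by_cases hx : x ∈ S
  · exact (otype_inter_Iic hS hx).le
  · refine (otype_mono (hS.mono Set.inter_subset_left) ?_).trans (le_add_of_nonneg_right zero_le)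
    rintro y ⟨hy, hyx⟩
    exact ⟨hy, lt_of_le_of_ne hyx fun h : y = x => hx (h ▸ hy)⟩

theorem omega0_mul_opow_natCast (k : ℕ) :
    ω * ω ^ (k : Ordinal.{0}) = ω ^ ((k + 1 : ℕ) : Ordinal) := by
  rw [add_comm k, Nat.cast_add, Nat.cast_one, Ordinal.opow_add, Ordinal.opow_one]

theorem add_one_lt_omega0_opow {o : Ordinal.{0}} {k : ℕ} (hk : 1 ≤ k) (h : o < ω ^ (k : Ordinal)) :
    o + 1 < ω ^ (k : Ordinal.{0}) := by
  have := Ordinal.isSuccLimit_opow_left Ordinal.isSuccLimit_omega0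
    (show (k : Ordinal.{0}) ≠ 0 by exact_mod_cast (by omega : k ≠ 0))
  exact this.add_one_lt h

theorem omega0_mul_add_nat_lt {a b c : Ordinal.{0}} (ha : a < ω * (b + 1)) (hc : c < ω) :
    a + c < ω * (b + 1) := by
  rw [mul_add_one] at ha ⊢
  rcases lt_or_ge a (ω * b) with h | h
  · exact (add_le_add_left h.le c).trans_lt (by gcongr)
  · obtain ⟨d, rfl⟩ := exists_add_of_le h
    rw [add_assoc]
    have hd : d < ω := by simpa using ha
    gcongr
    exact Ordinal.isPrincipal_add_omega0 hd hc

/-! ### The two bounds for the order types -/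

/-- Passing from `x - 1` to `x` multiplies the order type of `shiftedDefectSet` at most by `ω`,
since between consecutive accumulation points, which lie in the translate by `1` of the set, the
set has order type at most `ω`. -/
theorem otype_shiftedDefectSet_inter_Iio_lt (z : ℝ) :
    otype (shiftedDefectSet ∩ Set.Iio z) <
      ω * (otype (shiftedDefectSet ∩ Set.Iic (z - 1)) + 1) := by
  have hwf := isWF_shiftedDefectSet
  have hsub : ∀ T, (shiftedDefectSet ∩ T).IsWF := fun T => hwf.mono Set.inter_subset_left
  -- the step works for every real `z`; well-founded induction is needed for elements only
  have step : ∀ z : ℝ, (∀ w ∈ shiftedDefectSet, w < z → otype (shiftedDefectSet ∩ Set.Iio w) <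
      ω * (otype (shiftedDefectSet ∩ Set.Iic (w - 1)) + 1)) →
      otype (shiftedDefectSet ∩ Set.Iio z) <
        ω * (otype (shiftedDefectSet ∩ Set.Iic (z - 1)) + 1) := by
    intro z ih
    by_cases hfin : ∃ w ∈ shiftedDefectSet, w < z ∧ (shiftedDefectSet ∩ Set.Ico w z).Finite
    · obtain ⟨w, hw, hwz, hfin⟩ := hfin
      rw [otype_inter_Iio_eq_add hwf hwz.le]
      refine omega0_mul_add_nat_lt ((ih w hw hwz).trans_le ?_)
        ((otype_lt_omega0_iff (hsub _)).2 hfin)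
      gcongr
      exact otype_mono (hsub _) (by gcongr)
    · refine lt_of_le_of_lt (b := ω * otype (shiftedDefectSet ∩ Set.Iic (z - 1))) ?_ ?_
      · refine otype_le_of_forall_lt (hsub _) ?_
        rintro w ⟨hw, hwz⟩
        rw [Set.inter_assoc, Set.Iio_inter_Iio, min_eq_right hwz.le]
        refine (ih w hw hwz).trans_le ?_
        gcongr
        obtain ⟨y, hy, h1, h2⟩ :=
          exists_mem_of_infinite_inter_Ico (fun h => hfin ⟨w, hw, hwz, h⟩)
        rw [Order.add_one_le_iff]
        calc otype (shiftedDefectSet ∩ Set.Iic (w - 1))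
            ≤ otype (shiftedDefectSet ∩ Set.Iio y) :=
              otype_mono (hsub _) (Set.inter_subset_inter_right _ fun t ht => lt_of_le_of_lt ht h1)
          _ < otype (shiftedDefectSet ∩ Set.Iic y) := by
              rw [otype_inter_Iic hwf hy]; exact lt_add_one _
          _ ≤ _ := otype_mono (hsub _) (by gcongr)
      · exact mul_lt_mul_of_pos_left (lt_add_one _) Ordinal.omega0_pos
  refine step z fun w hw _ => ?_
  refine Set.WellFoundedOn.induction hwf hw (fun v hv ih => step v ih)

theorem otype_shiftedDefectSet_inter_Iio_lt_opow {k : ℕ} (hk : 1 ≤ k) {x : ℝ} (hx : x < k) :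
    otype (shiftedDefectSet ∩ Set.Iio x) < ω ^ (k : Ordinal.{0}) := by
  induction k, hk using Nat.le_induction generalizing x with
  | base =>
    have h0 : shiftedDefectSet ∩ Set.Iic (x - 1) = ∅ := by
      refine Set.eq_empty_of_forall_notMem fun y ⟨hy, hyx⟩ => ?_
      have := shiftedDefectSet_nonneg hy
      have : y ≤ x - 1 := hyx
      push_cast at hx
      linarith
    have he : otype (∅ : Set ℝ) = 0 := by
      have := isWellOrder_of_isWF (Set.isWF_empty (α := ℝ))
      rw [otype_eq]
      exact Ordinal.type_eq_zero_of_empty _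
    have := otype_shiftedDefectSet_inter_Iio_lt x
    rw [h0, he] at this
    simpa using this
  | succ k hk ih =>
    refine (otype_shiftedDefectSet_inter_Iio_lt x).trans ?_
    rw [← omega0_mul_opow_natCast]
    refine mul_lt_mul_of_pos_left ?_ Ordinal.omega0_pos
    have h1 := ih (x := x - 1) (by push_cast at hx; linarith)
    exact add_one_lt_omega0_opow hk ((otype_inter_Iic_le isWF_shiftedDefectSet _).trans_lt
      (add_one_lt_omega0_opow hk h1))

theorem stableDefectSetMod_subset (a : ZMod 3) : stableDefectSetMod a ⊆ shiftedDefectSet := by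
  intro x hx
  obtain ⟨n, hn, -, -, -, rfl⟩ := mem_stableDefectSetMod_iff.1 hx
  exact defect_mem_shiftedDefectSet hn

theorem isWF_stableDefectSetMod_inter (a : ZMod 3) (T : Set ℝ) :
    (stableDefectSetMod a ∩ T).IsWF :=
  isWF_shiftedDefectSet.mono (Set.inter_subset_left.trans (stableDefectSetMod_subset a))

theorem infinite_stableDefectSetMod_inter_Ico {a : ZMod 3} {x y : ℝ}
    (hx : x ∈ stableDefectSetMod a) (hy : y < x + 1) :
    (stableDefectSetMod (a + 1) ∩ Set.Ico y (x + 1)).Infinite := by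
  intro hfin
  obtain ⟨z, hz, h1, h2⟩ := exists_mem_stableDefectSetMod_add_one hx hy
  obtain ⟨w, hw, hmax⟩ := hfin.exists_maximal ⟨z, hz, h1.le, h2⟩
  obtain ⟨v, hv, h3, h4⟩ := exists_mem_stableDefectSetMod_add_one hx hw.2.2
  exact absurd (hmax ⟨hv, (hw.2.1.trans h3.le), h4⟩ h3.le) (not_le.2 h3)

/-- Passing from `x` to `x + 1` multiplies the rank of an element of `stableDefectSetMod a` at least
by `ω`: the translates by `1` of the elements below `x` are separated by infinitely many elements of
`stableDefectSetMod (a + 1)`. -/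
theorem omega0_mul_otype_le {a : ZMod 3} {x : ℝ} (hx : x ∈ stableDefectSetMod a) :
    ω * otype (stableDefectSetMod a ∩ Set.Iio x) ≤
      otype (stableDefectSetMod (a + 1) ∩ Set.Iio (x + 1)) := by
  have hwf : (stableDefectSetMod a).IsWF :=
    isWF_shiftedDefectSet.mono (stableDefectSetMod_subset a)
  refine Set.WellFoundedOn.induction (P := fun x => ω * otype (stableDefectSetMod a ∩ Set.Iio x) ≤
    otype (stableDefectSetMod (a + 1) ∩ Set.Iio (x + 1))) hwf hx fun x hx ih => ?_
  refine le_of_forall_lt fun o ho => ?_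
  obtain ⟨q, hq, r, hr, rfl⟩ := Ordinal.lt_mul_iff.1 ho
  obtain ⟨y, ⟨hy, hyx⟩, rfl⟩ := exists_otype_inter_Iio_eq (isWF_stableDefectSetMod_inter _ _) hq
  rw [Set.inter_assoc, Set.Iio_inter_Iio, min_eq_right hyx.le]
  have hyx1 : y + 1 < x + 1 := by have : y < x := hyx; linarith
  rw [otype_inter_Iio_eq_add
    (isWF_shiftedDefectSet.mono (stableDefectSetMod_subset (a + 1))) hyx1.le]
  have hinf : ω ≤ otype (stableDefectSetMod (a + 1) ∩ Set.Ico (y + 1) (x + 1)) := by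
    rw [← not_lt, otype_lt_omega0_iff (isWF_stableDefectSetMod_inter _ _)]
    exact infinite_stableDefectSetMod_inter_Ico hx hyx1
  exact (add_le_add_left (ih y hy hyx) r).trans_lt (by gcongr; exact hr.trans_le hinf)

theorem zero_mem_stableDefectSetMod : (0 : ℝ) ∈ stableDefectSetMod 0 :=
  mem_stableDefectSetMod_iff.2
    ⟨3, by norm_num, by norm_num, isStable_three, by rw [complexity_three]; rfl, defect_three⟩

theorem opow_le_otype_stableDefectSetMod {k : ℕ} (hk : 1 ≤ k) :
    ω ^ (k : Ordinal.{0}) ≤ otype (stableDefectSetMod (k : ZMod 3) ∩ Set.Iio (k : ℝ)) := by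
  induction k, hk using Nat.le_induction with
  | base =>
    rw [Nat.cast_one, Ordinal.opow_one, ← not_lt,
      otype_lt_omega0_iff (isWF_stableDefectSetMod_inter _ _)]
    have := infinite_stableDefectSetMod_inter_Ico (y := 0) zero_mem_stableDefectSetMod (by norm_num)
    refine this.mono ?_
    simp only [zero_add, Nat.cast_one]
    exact Set.inter_subset_inter_right _ fun t ht => ht.2
  | succ k hk ih =>
    rw [← omega0_mul_opow_natCast]
    refine le_of_forall_lt fun o ho => ?_
    -- the element of rank `q + 1` exists since `ω ^ k` is a limit ordinal, and gives room for `r`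
    obtain ⟨q, hq, r, hr, rfl⟩ := Ordinal.lt_mul_iff.1 ho
    obtain ⟨y, ⟨hy, hyk⟩, hyq⟩ := exists_otype_inter_Iio_eq (isWF_stableDefectSetMod_inter _ _)
      ((add_one_lt_omega0_opow hk hq).trans_le ih)
    rw [Set.inter_assoc, Set.Iio_inter_Iio, min_eq_right hyk.le] at hyq
    have h1 := omega0_mul_otype_le hy
    rw [hyq, mul_add_one] at h1
    have h2 : ω * q + r < ω * q + ω := by gcongr
    refine (h2.trans_le h1).trans_le ?_
    rw [Nat.cast_succ]
    refine otype_mono (isWF_stableDefectSetMod_inter _ _) (Set.inter_subset_inter_right _ ?_)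
    intro t ht
    have h3 : t < y + 1 := ht
    have h4 : y < k := hyk
    show t < ((k + 1 : ℕ) : ℝ)
    push_cast
    linarith

/-! ### Sets between the stable defects and the shifted defects -/

theorem otype_inter_Iio_natCast {S : Set ℝ} {k : ℕ} (hk : 1 ≤ k)
    (hS : stableDefectSetMod (k : ZMod 3) ⊆ S) (hS' : S ⊆ shiftedDefectSet) :
    otype (S ∩ Set.Iio (k : ℝ)) = ω ^ (k : Ordinal.{0}) := by
  have hwf : ∀ T, (S ∩ T).IsWF := fun T =>
    isWF_shiftedDefectSet.mono (Set.inter_subset_left.trans hS')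
  refine le_antisymm (otype_le_of_forall_lt (hwf _) ?_)
    ((opow_le_otype_stableDefectSetMod hk).trans (otype_mono (hwf _) (by gcongr)))
  rintro x ⟨-, hx⟩
  refine lt_of_le_of_lt (otype_mono (isWF_shiftedDefectSet.mono Set.inter_subset_left) ?_)
    (otype_shiftedDefectSet_inter_Iio_lt_opow hk hx)
  exact Set.inter_subset_inter_left _ (Set.inter_subset_left.trans hS')

theorem hasOrderType_inter_Iio_natCast {S : Set ℝ} {k : ℕ} (hk : 1 ≤ k)
    (hS : stableDefectSetMod (k : ZMod 3) ⊆ S) (hS' : S ⊆ shiftedDefectSet) :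
    HasOrderType (S ∩ Set.Iio (k : ℝ)) (ω ^ k) := by
  rw [← Ordinal.opow_natCast]
  exact hasOrderType_of_otype_eq (isWF_shiftedDefectSet.mono (Set.inter_subset_left.trans hS'))
    (otype_inter_Iio_natCast hk hS hS')

theorem hasOrderType_inter_Icc {S : Set ℝ} {k : ℕ} (hk : k ≠ 0 → (k : ℝ) ∉ S)
    (hS : stableDefectSetMod (k : ZMod 3) ⊆ S) (hS' : S ⊆ shiftedDefectSet) :
    HasOrderType (S ∩ Set.Icc 0 (k : ℝ)) (ω ^ k) := by
  rcases Nat.eq_zero_or_pos k with rfl | hpos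
  · have h : S ∩ Set.Icc 0 ((0 : ℕ) : ℝ) = {0} := by
      rw [Nat.cast_zero, Set.Icc_self, Set.inter_eq_right, Set.singleton_subset_iff]
      exact hS zero_mem_stableDefectSetMod
    rw [h, pow_zero]
    exact hasOrderType_of_otype_eq (Set.finite_singleton _).isWF (otype_singleton 0)
  · have h : S ∩ Set.Icc 0 (k : ℝ) = S ∩ Set.Iio (k : ℝ) := by
      ext x
      refine ⟨fun ⟨hx, hx'⟩ => ⟨hx, lt_of_le_of_ne hx'.2 ?_⟩, fun ⟨hx, hx'⟩ =>
        ⟨hx, shiftedDefectSet_nonneg (hS' hx), le_of_lt hx'⟩⟩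
      rintro rfl
      exact hk (by omega) hx
    rw [h]
    exact hasOrderType_inter_Iio_natCast hpos hS hS'

theorem hasOrderType_omega0_opow_omega0 {S : Set ℝ} {a : ZMod 3}
    (hS : stableDefectSetMod a ⊆ S) (hS' : S ⊆ shiftedDefectSet) :
    HasOrderType S (ω ^ ω) := by
  have hwf : S.IsWF := isWF_shiftedDefectSet.mono hS'
  refine hasOrderType_of_otype_eq hwf (le_antisymm (otype_le_of_forall_lt hwf fun x _ => ?_) ?_)
  · obtain ⟨k, hk⟩ := exists_nat_gt (max x 0)
    have hk1 : 1 ≤ k := by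
      have : (0 : ℝ) < k := (le_max_right _ _).trans_lt hk
      exact_mod_cast this
    calc otype (S ∩ Set.Iio x) ≤ otype (shiftedDefectSet ∩ Set.Iio x) :=
          otype_mono (isWF_shiftedDefectSet.mono Set.inter_subset_left) (by gcongr)
      _ < ω ^ (k : Ordinal) :=
          otype_shiftedDefectSet_inter_Iio_lt_opow hk1 ((le_max_left _ _).trans_lt hk)
      _ ≤ ω ^ ω := Ordinal.opow_le_opow_right Ordinal.omega0_pos (Ordinal.natCast_lt_omega0 k).le
  · refine le_of_forall_lt fun o ho => ?_
    obtain ⟨c, hc, h⟩ := (Ordinal.lt_opow_of_isSuccLimit Ordinal.omega0_ne_zero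
      Ordinal.isSuccLimit_omega0).1 ho
    obtain ⟨n, rfl⟩ := Ordinal.lt_omega0.1 hc
    -- an integer `k ≥ max n 1` in the residue class of `a`
    obtain ⟨k, hk1, hkn, rfl⟩ : ∃ k : ℕ, 1 ≤ k ∧ n ≤ k ∧ (k : ZMod 3) = a := by
      refine ⟨3 * (n + 1) + a.val, by omega, by omega, ?_⟩
      push_cast
      rw [show (3 : ZMod 3) = 0 from rfl, ZMod.natCast_zmod_val]
      ring
    calc o < ω ^ (n : Ordinal) := h
      _ ≤ ω ^ (k : Ordinal) :=
          Ordinal.opow_le_opow_right Ordinal.omega0_pos (by exact_mod_cast hkn)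
      _ = otype (S ∩ Set.Iio (k : ℝ)) := (otype_inter_Iio_natCast hk1 hS hS').symm
      _ ≤ otype S := otype_mono hwf Set.inter_subset_left

/-- For `k ≥ 1` the stable defects of the class of `k` below `k` accumulate at `k`, since those
below any smaller bound have order type less than `ω ^ k`. -/
theorem natCast_mem_closure {S : Set ℝ} {k : ℕ} (hk : 1 ≤ k)
    (hS : stableDefectSetMod (k : ZMod 3) ⊆ S) (hS' : S ⊆ shiftedDefectSet) :
    (k : ℝ) ∈ closure S := by
  refine Metric.mem_closure_iff.2 fun ε hε => ?_
  have h : otype (S ∩ Set.Iio (k - ε / 2)) < otype (S ∩ Set.Iio (k : ℝ)) := by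
    rw [otype_inter_Iio_natCast hk hS hS']
    exact (otype_mono (isWF_shiftedDefectSet.mono Set.inter_subset_left) (by gcongr)).trans_lt
      (otype_shiftedDefectSet_inter_Iio_lt_opow hk (by linarith))
  have hne : ¬ S ∩ Set.Iio (k : ℝ) ⊆ S ∩ Set.Iio (k - ε / 2) := fun hsub =>
    absurd (otype_mono (isWF_shiftedDefectSet.mono (Set.inter_subset_left.trans hS')) hsub)
      (not_le.2 h)
  obtain ⟨x, ⟨hx, hxk⟩, hx'⟩ := Set.not_subset.1 hne
  have h1 : x < k := hxk
  have h2 : k - ε / 2 ≤ x := not_lt.1 fun h => hx' ⟨hx, h⟩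
  refine ⟨x, hx, ?_⟩
  rw [Real.dist_eq, abs_of_pos] <;> linarith

theorem hasOrderType_closure_inter_Icc {S : Set ℝ} {k : ℕ} (hk : 1 ≤ k)
    (hS : stableDefectSetMod (k : ZMod 3) ⊆ S) (hS' : S ⊆ shiftedDefectSet) :
    HasOrderType (closure S ∩ Set.Icc 0 (k : ℝ)) (ω ^ k + 1) ∧ (k : ℝ) ∈ closure S ∧
      IsNthElement (closure S) (ω ^ k) (k : ℝ) := by
  have hcl : closure S ⊆ shiftedDefectSet := closure_minimal hS' isClosed_shiftedDefectSet
  have hwf : (closure S).IsWF := isWF_shiftedDefectSet.mono hcl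
  have hS1 := hS.trans subset_closure
  have hmem := natCast_mem_closure hk hS hS'
  refine ⟨?_, hmem, hwf, hmem, hasOrderType_inter_Iio_natCast hk hS1 hcl⟩
  have h : closure S ∩ Set.Icc 0 (k : ℝ) = closure S ∩ Set.Iic (k : ℝ) := by
    ext x
    exact ⟨fun hx => ⟨hx.1, hx.2.2⟩, fun hx => ⟨hx.1, shiftedDefectSet_nonneg (hcl hx.1), hx.2⟩⟩
  rw [h]
  refine hasOrderType_of_otype_eq (hwf.mono Set.inter_subset_left) ?_
  rw [otype_inter_Iic hwf hmem, otype_inter_Iio_natCast hk hS1 hcl, Ordinal.opow_natCast]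

theorem stableDefectSetMod_subset_stableDefectSet (a : ZMod 3) :
    stableDefectSetMod a ⊆ stableDefectSet :=
  Set.inter_subset_right

theorem stableDefectSetMod_subset_defectSetMod (a : ZMod 3) :
    stableDefectSetMod a ⊆ defectSetMod a :=
  Set.inter_subset_left

theorem stableDefectSet_subset_defectSet : stableDefectSet ⊆ defectSet := by
  rintro x ⟨n, hn, -, rfl⟩
  exact ⟨n, hn, rfl⟩

theorem defectSetMod_subset_defectSet (a : ZMod 3) : defectSetMod a ⊆ defectSet := by
  rintro x ⟨n, hn, -, -, rfl⟩
  exact ⟨n, hn, rfl⟩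

theorem defectSet_subset_shiftedDefectSet : defectSet ⊆ shiftedDefectSet := by
  rintro x ⟨n, hn, rfl⟩
  exact defect_mem_shiftedDefectSet hn

theorem natCast_notMem_stableDefectSet {k : ℕ} (hk : k ≠ 0) : (k : ℝ) ∉ stableDefectSet := by
  rintro ⟨n, hn, hs, h⟩
  rcases defect_eq_nat hn h with rfl | rfl
  · exact not_isStable_one hs
  · exact hk rfl

theorem natCast_notMem_defectSetMod {a : ZMod 3} {k : ℕ} (hk : k ≠ 0) :
    (k : ℝ) ∉ defectSetMod a := by
  rintro ⟨n, hn, hn1, -, h⟩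
  exact (defect_eq_nat hn h).elim hn1 hk

theorem natCast_notMem_defectSet {k : ℕ} (hk : k ≠ 0) (hk1 : k ≠ 1) : (k : ℝ) ∉ defectSet := by
  rintro ⟨n, hn, h⟩
  rcases defect_eq_nat hn h with rfl | rfl
  · rw [defect_one] at h
    exact hk1 (by exact_mod_cast h.symm)
  · exact hk rfl

end IntegerComplexity

theorem mainTheorem6 :
    -- (1) the defect set and the stable defect set
    ((HasOrderType defectSet (ω ^ ω) ∧ HasOrderType stableDefectSet (ω ^ ω)) ∧
      (∀ k : ℕ, HasOrderType (stableDefectSet ∩ Set.Icc 0 (k : ℝ)) (ω ^ k)) ∧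
      (∀ k : ℕ, k ≠ 1 → HasOrderType (defectSet ∩ Set.Icc 0 (k : ℝ)) (ω ^ k))) ∧
    -- (2) their closures
    ((HasOrderType (closure stableDefectSet) (ω ^ ω) ∧
        HasOrderType (closure defectSet) (ω ^ ω)) ∧
      (∀ k : ℕ, 1 ≤ k →
        (HasOrderType (closure stableDefectSet ∩ Set.Icc 0 (k : ℝ)) (ω ^ k + 1) ∧
          (k : ℝ) ∈ closure stableDefectSet ∧
          IsNthElement (closure stableDefectSet) (ω ^ k) (k : ℝ)) ∧
        (HasOrderType (closure defectSet ∩ Set.Icc 0 (k : ℝ)) (ω ^ k + 1) ∧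
          (k : ℝ) ∈ closure defectSet ∧
          IsNthElement (closure defectSet) (ω ^ k) (k : ℝ)))) ∧
    -- (3) the defect sets and stable defect sets of a congruence class modulo 3
    (∀ a : ZMod 3,
      (HasOrderType (defectSetMod a) (ω ^ ω) ∧ HasOrderType (stableDefectSetMod a) (ω ^ ω)) ∧
      (∀ k : ℕ, (k : ZMod 3) = a →
        HasOrderType (defectSetMod a ∩ Set.Icc 0 (k : ℝ)) (ω ^ k) ∧
        HasOrderType (stableDefectSetMod a ∩ Set.Icc 0 (k : ℝ)) (ω ^ k))) ∧
    -- (4) their closures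
    (∀ a : ZMod 3,
      (HasOrderType (closure (defectSetMod a)) (ω ^ ω) ∧
        HasOrderType (closure (stableDefectSetMod a)) (ω ^ ω)) ∧
      (∀ k : ℕ, 1 ≤ k → (k : ZMod 3) = a →
        (HasOrderType (closure (defectSetMod a) ∩ Set.Icc 0 (k : ℝ)) (ω ^ k + 1) ∧
          (k : ℝ) ∈ closure (defectSetMod a) ∧
          IsNthElement (closure (defectSetMod a)) (ω ^ k) (k : ℝ)) ∧
        (HasOrderType (closure (stableDefectSetMod a) ∩ Set.Icc 0 (k : ℝ)) (ω ^ k + 1) ∧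
          (k : ℝ) ∈ closure (stableDefectSetMod a) ∧
          IsNthElement (closure (stableDefectSetMod a)) (ω ^ k) (k : ℝ)))) := by
  have hst := stableDefectSetMod_subset_stableDefectSet
  have hmod := stableDefectSetMod_subset_defectSetMod
  have hD := fun a => (hst a).trans stableDefectSet_subset_defectSet
  have hDZ := defectSet_subset_shiftedDefectSet
  have hstZ := stableDefectSet_subset_defectSet.trans hDZ
  have hmodZ := fun a => (defectSetMod_subset_defectSet a).trans hDZ
  have hmstZ := stableDefectSetMod_subset
  have hcl : ∀ {S : Set ℝ}, S ⊆ shiftedDefectSet → closure S ⊆ shiftedDefectSet := fun h =>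
    closure_minimal h isClosed_shiftedDefectSet
  refine ⟨⟨⟨hasOrderType_omega0_opow_omega0 (hD 0) hDZ,
      hasOrderType_omega0_opow_omega0 (hst 0) hstZ⟩, fun k => ?_, fun k hk1 => ?_⟩,
    ⟨⟨hasOrderType_omega0_opow_omega0 ((hst 0).trans subset_closure) (hcl hstZ),
      hasOrderType_omega0_opow_omega0 ((hD 0).trans subset_closure) (hcl hDZ)⟩, fun k hk =>
      ⟨hasOrderType_closure_inter_Icc hk (hst _) hstZ,
        hasOrderType_closure_inter_Icc hk (hD _) hDZ⟩⟩,
    fun a => ⟨⟨hasOrderType_omega0_opow_omega0 (hmod a) (hmodZ a),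
      hasOrderType_omega0_opow_omega0 subset_rfl (hmstZ a)⟩, ?_⟩,
    fun a => ⟨⟨hasOrderType_omega0_opow_omega0 ((hmod a).trans subset_closure) (hcl (hmodZ a)),
      hasOrderType_omega0_opow_omega0 subset_closure (hcl (hmstZ a))⟩, ?_⟩⟩
  · exact hasOrderType_inter_Icc natCast_notMem_stableDefectSet (hst _) hstZ
  · exact hasOrderType_inter_Icc (natCast_notMem_defectSet · hk1) (hD _) hDZ
  · rintro k rfl
    exact ⟨hasOrderType_inter_Icc natCast_notMem_defectSetMod (hmod _) (hmodZ _),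
      hasOrderType_inter_Icc (fun hk h => natCast_notMem_defectSetMod hk (hmod _ h))
        subset_rfl (hmstZ _)⟩
  · rintro k hk rfl
    exact ⟨hasOrderType_closure_inter_Icc hk (hmod _) (hmodZ _),
      hasOrderType_closure_inter_Icc hk subset_rfl (hmstZ _)⟩
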